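/- All graphs are finite and simple. A graph is \emph{locally irregular} if any two adjacent vertices have distinct degrees. A graph $G=(V,E)$ \emph{can be decomposed into $k$ locally irregular subgraphs} if there are pairwise disjoint (possibly empty) sets $E_1,\dots,E_k$ with $E=E_1\cup\dots\cup E_k$ such that each graph $H_i=(V,E_i)$, $i=1,\dots,k$, is locally irregular. \textbf{Theorem.} Every graph $G$ with minimum degree $\delta(G)\geq 10^{10}$ can be decomposed into three locally irregular subgraphs. -/

import Mathlib

namespace SimpleGraph

open Classical in
/-- A finite graph is locally irregular if adjacent vertices have distinct degrees. -/
def IsLocallyIrregular {V : Type*} [Fintype V] (H : SimpleGraph V) : Prop :=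
  ∀ u v : V, H.Adj u v → H.degree u ≠ H.degree v

/-- `G = (V, E)` can be decomposed into `k` locally irregular subgraphs: `E` is the union of
pairwise disjoint sets `E₁, …, Eₖ` such that every spanning subgraph `(V, Eᵢ)` is locally
irregular. -/
def IsLocallyIrregularDecomposable {V : Type*} [Fintype V] (G : SimpleGraph V) (k : ℕ) : Prop :=
  ∃ E : Fin k → Set (Sym2 V),
    (⋃ i, E i) = G.edgeSet ∧
    (∀ i j, i ≠ j → Disjoint (E i) (E j)) ∧
    ∀ i, (fromEdgeSet (E i)).IsLocallyIrregular

end SimpleGraph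

open Finset

/-! A vertex of degree `d` is assigned four admissible degrees in the first subgraph, near `d / 2`,
and four in the second, near `d / 4`, both translated by shifts below `d / 100`; its third degree
then has at most 16 possible values. An edge conflicts in a subgraph if its ends share an admissible
degree there. For fixed data at a neighbour few shifts create a conflict, so averaging
(`exists_shifts`) gives shifts with fewer than 30000 conflicts at each vertex; a heavy penalty also
rules out edges conflicting in both the second and the third subgraph.

It remains to realise admissible degrees while keeping each edge out of the subgraphs where it
conflicts (`exists_decomposition_avoiding`). The first subgraph is chosen among edges without a
first conflict. Of the remaining edges, those conflicting in the second are forced into the third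
and vice versa; the boundedly many forced edges at a vertex are absorbed by slack of order `d /
100`.

The degrees are realised by `exists_subset_edgeDeg`: two pairs of consecutive values, on either side
of half the degree, can be prescribed at each vertex. In an optimal subgraph with a deficient
vertex, counting edges between the even and odd ends of alternating trails gives a contradiction. -/

theorem sum_card_filter_comm {V : Type*} (A B : Finset V) (p : Sym2 V → Prop) [DecidablePred p] :
    ∑ y ∈ A, #{x ∈ B | p s(y, x)} = ∑ x ∈ B, #{y ∈ A | p s(x, y)} := by
  have := sum_card_bipartiteAbove_eq_sum_card_bipartiteBelow (s := A) (t := B)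
    (fun y x => p s(y, x))
  simpa [bipartiteAbove, bipartiteBelow, Sym2.eq_swap] using this

/-! ### Degree constrained subgraphs by alternating trails -/

section DegreeConstrained

variable {V : Type*} [DecidableEq V]

/-- The edges joining `x` to the vertices of `S`. -/
def starEdges (x : V) (S : Finset V) : Finset (Sym2 V) := S.image fun y => s(x, y)

theorem mem_starEdges {x : V} {S : Finset V} {u w : V} :
    s(u, w) ∈ starEdges x S ↔ (u = x ∧ w ∈ S) ∨ (w = x ∧ u ∈ S) := by
  simp only [starEdges, mem_image, Sym2.eq_iff]
  constructor
  · rintro ⟨y, hy, ⟨rfl, rfl⟩ | ⟨rfl, rfl⟩⟩ <;> simp [hy]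
  · rintro (⟨rfl, h⟩ | ⟨rfl, h⟩)
    · exact ⟨w, h, .inl ⟨rfl, rfl⟩⟩
    · exact ⟨u, h, .inr ⟨rfl, rfl⟩⟩

/-- `AltTrail E H v K z p`: there is an alternating trail from `v` to `z` in the graph with edge set
`E`, beginning with an edge outside `H`, of odd length iff `p`, such that flipping its edges turns
`H` into `K`. -/
inductive AltTrail (E H : Finset (Sym2 V)) (v : V) : Finset (Sym2 V) → V → Bool → Prop
  | nil : AltTrail E H v H v false
  -- Requiring `H` and `K` to agree on the new edge means that it is not yet flipped, so no edge is
  -- repeated.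
  | add {K : Finset (Sym2 V)} {y x : V} : AltTrail E H v K y false → s(y, x) ∈ E →
      s(y, x) ∉ H → s(y, x) ∉ K → AltTrail E H v (insert s(y, x) K) x true
  | remove {K : Finset (Sym2 V)} {x y : V} : AltTrail E H v K x true → s(x, y) ∈ H →
      s(x, y) ∈ K → AltTrail E H v (K.erase s(x, y)) y false

namespace AltTrail

variable {E H K : Finset (Sym2 V)} {v z : V} {p : Bool}

theorem subset (hH : H ⊆ E) (h : AltTrail E H v K z p) : K ⊆ E := by
  induction h with
  | nil => exact hH
  | add _ h1 _ _ ih => exact insert_subset h1 ih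
  | remove _ _ _ ih => exact (erase_subset _ _).trans ih

/-- Every edge of an alternating trail joins an even vertex to an odd one. -/
theorem flipped (h : AltTrail E H v K z p) {e : Sym2 V} (he : ¬ (e ∈ K ↔ e ∈ H)) :
    ∃ a b, e = s(a, b) ∧ (∃ K', AltTrail E H v K' a false) ∧ ∃ K', AltTrail E H v K' b true := by
  induction h with
  | nil => simp at he
  | @add K y x h h1 h2 h3 ih =>
    by_cases hh : e = s(y, x)
    · exact ⟨y, x, hh, ⟨_, h⟩, ⟨_, h.add h1 h2 h3⟩⟩
    · exact ih (by simpa [hh] using he)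
  | @remove K x y h h2 h3 ih =>
    by_cases hh : e = s(x, y)
    · exact ⟨y, x, hh.trans Sym2.eq_swap, ⟨_, h.remove h2 h3⟩, ⟨_, h⟩⟩
    · exact ih (by simpa [hh] using he)

end AltTrail

variable [Fintype V]

/-- The degree of `v` in the graph with edge set `F`. -/
def edgeDeg (F : Finset (Sym2 V)) (v : V) : ℕ := #{u | s(v, u) ∈ F}

theorem edgeDeg_union {F F' : Finset (Sym2 V)} (h : Disjoint F F') (v : V) :
    edgeDeg (F ∪ F') v = edgeDeg F v + edgeDeg F' v := by
  unfold edgeDeg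
  rw [← card_union_of_disjoint]
  · congr 1; ext u; simp
  · rw [Finset.disjoint_left] at h ⊢
    intro u hu hu'
    exact h (by simpa using hu) (by simpa using hu')

theorem edgeDeg_mono {F F' : Finset (Sym2 V)} (h : F ⊆ F') (v : V) :
    edgeDeg F v ≤ edgeDeg F' v :=
  card_le_card fun u hu => by simpa using h (by simpa using hu)

theorem edgeDeg_sdiff {F F' : Finset (Sym2 V)} (h : F' ⊆ F) (v : V) :
    edgeDeg (F \ F') v + edgeDeg F' v = edgeDeg F v := by
  rw [← edgeDeg_union sdiff_disjoint, sdiff_union_of_subset h]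

theorem edgeDeg_starEdges_self {x : V} {S : Finset V} (hx : x ∉ S) : edgeDeg (starEdges x S) x = #S := by
  unfold edgeDeg
  congr 1; ext u
  simp only [mem_filter, mem_univ, true_and, mem_starEdges]
  constructor
  · rintro (h | ⟨rfl, h⟩)
    · exact h
    · exact h
  · exact fun h => .inl h

theorem edgeDeg_starEdges_of_ne {x : V} {S : Finset V} {u : V} (hu : u ≠ x) :
    edgeDeg (starEdges x S) u = if u ∈ S then 1 else 0 := by
  unfold edgeDeg
  simp only [mem_starEdges, hu, false_and, false_or]
  split_ifs with h
  · simp [h, filter_eq']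
  · simp [h]

theorem edgeDeg_singleton {x y : V} (hxy : x ≠ y) (u : V) :
    edgeDeg {s(x, y)} u = (if u = x then 1 else 0) + if u = y then 1 else 0 := by
  have h : ({s(x, y)} : Finset (Sym2 V)) = starEdges x {y} := by simp [starEdges]
  rw [h]
  by_cases hu : u = x
  · subst hu
    rw [edgeDeg_starEdges_self (by simpa using hxy)]
    simp [hxy]
  · rw [edgeDeg_starEdges_of_ne hu]
    simp [hu]

theorem edgeDeg_eq_add (F : Finset (Sym2 V)) (y : V) (B : Finset V) :
    edgeDeg F y = #{x ∈ B | s(y, x) ∈ F} + #{x | s(y, x) ∈ F ∧ x ∉ B} := by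
  unfold edgeDeg
  rw [← card_union_of_disjoint]
  · congr 1; ext x; simp only [mem_union, mem_filter, mem_univ, true_and]; tauto
  · rw [Finset.disjoint_left]; intro x; simp only [mem_filter]; tauto

namespace AltTrail

variable {E H K : Finset (Sym2 V)} {v z : V} {p : Bool}

/-- Alternation cancels at interior passages: the start gains one, and the end gains or loses one
according to parity. The additive form avoids truncated subtraction. -/
theorem edgeDeg_eq (hE : ∀ e ∈ E, ¬ e.IsDiag) (hH : H ⊆ E) (h : AltTrail E H v K z p) (u : V) :
    edgeDeg K u + (if u = z ∧ p = false then 1 else 0) =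
      edgeDeg H u + (if u = v then 1 else 0) + (if u = z ∧ p = true then 1 else 0) := by
  induction h with
  | nil => simp
  | @add K y x h h1 h2 h3 ih =>
    have hne : y ≠ x := fun e => hE _ h1 (by simp [e])
    have hd : Disjoint {s(y, x)} K := by simpa using h3
    rw [insert_eq, edgeDeg_union hd, edgeDeg_singleton hne]
    simp only [and_true, Bool.false_eq_true, and_false, if_false, Bool.true_eq_false] at ih ⊢
    omega
  | @remove K x y h h2 h3 ih =>
    have hne : x ≠ y := fun e => hE _ (hH h2) (by simp [e])
    have := edgeDeg_sdiff (F := K) (F' := {s(x, y)}) (by simpa using h3) u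
    rw [edgeDeg_singleton hne] at this
    rw [erase_eq]
    simp only [and_true, Bool.false_eq_true, and_false, if_false, Bool.true_eq_false] at ih ⊢
    omega

end AltTrail

/-- `K` is a subgraph of `E` whose degrees exceed the targets `f`, each chosen from two values,
by at most one. -/
structure IsFeasible (E : Finset (Sym2 V)) (a b : V → ℕ) (K : Finset (Sym2 V)) (f : V → ℕ) :
    Prop where
  subset : K ⊆ E
  target : ∀ v, f v = a v ∨ f v = b v
  le : ∀ v, edgeDeg K v ≤ f v + 1

/-- `H` with targets `f` has the least total deficiency, and `v` is deficient. -/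
structure IsDeficientOptimum (E : Finset (Sym2 V)) (a b : V → ℕ) (H : Finset (Sym2 V))
    (f : V → ℕ) (v : V) : Prop where
  loopless : ∀ e ∈ E, ¬ e.IsDiag
  feasible : IsFeasible E a b H f
  min : ∀ K g, IsFeasible E a b K g → ∑ u, (f u - edgeDeg H u) ≤ ∑ u, (g u - edgeDeg K u)
  deficient : edgeDeg H v < f v

namespace IsDeficientOptimum

variable {E H : Finset (Sym2 V)} {a b f : V → ℕ} {v : V}

theorem no_improvement (h : IsDeficientOptimum E a b H f v)
    {K : Finset (Sym2 V)} {g : V → ℕ} (hf : IsFeasible E a b K g)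
    (hle : ∀ u, g u - edgeDeg K u ≤ f u - edgeDeg H u)
    (hlt : g v - edgeDeg K v < f v - edgeDeg H v) : False :=
  (h.min K g hf).not_gt (sum_lt_sum (fun u _ => hle u) ⟨v, mem_univ v, hlt⟩)

/-- Otherwise flipping the trail stays feasible and lowers the deficiency of `v`; if the trail
closes at `v`, its deficiency leaves room for both new units. -/
theorem odd_end (h : IsDeficientOptimum E a b H f v) {K : Finset (Sym2 V)} {x : V}
    (ht : AltTrail E H v K x true) : x ≠ v ∧ edgeDeg H x = f x + 1 := by
  have hd := ht.edgeDeg_eq h.loopless h.feasible.subset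
  simp only [and_true, Bool.true_eq_false, and_false, if_false, add_zero] at hd
  have hv := h.deficient
  by_contra hc
  refine h.no_improvement (K := K) (g := f)
    ⟨ht.subset h.feasible.subset, h.feasible.target, fun u => ?_⟩ (fun u => ?_) ?_
  · have h1 := hd u
    have h2 := h.feasible.le u
    split_ifs at h1 with huv hux hux
    · subst huv; omega
    · subst huv; omega
    · subst hux
      have : edgeDeg H u ≠ f u + 1 := fun he => hc ⟨huv, he⟩
      omega
    · omega
  · have := hd u; omega
  · have := hd v; rw [if_pos rfl] at this; omega

/-- Otherwise flipping moves a surplus unit from `y` to `v`. -/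
theorem even_end (h : IsDeficientOptimum E a b H f v) {K : Finset (Sym2 V)} {y : V}
    (ht : AltTrail E H v K y false) : edgeDeg H y ≤ f y := by
  have hd := ht.edgeDeg_eq h.loopless h.feasible.subset
  simp only [and_true, Bool.false_eq_true, and_false, if_false, add_zero] at hd
  have hv := h.deficient
  by_contra hc
  have hyv : y ≠ v := by rintro rfl; omega
  refine h.no_improvement (K := K) (g := f)
    ⟨ht.subset h.feasible.subset, h.feasible.target, fun u => ?_⟩ (fun u => ?_) ?_
  · have := hd u; have := h.feasible.le u
    by_cases h1 : u = v
    · subst h1; simp at this; split_ifs at * <;> omega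
    · simp [h1] at *; omega
  · have := hd u
    by_cases h2 : u = y
    · subst h2; simp [hyv] at this; omega
    · simp [h2] at this; omega
  · have := hd v; simp [hyv.symm] at this; omega

open Classical in
/-- The ends of alternating trails of even length. -/
noncomputable def even (_ : IsDeficientOptimum E a b H f v) : Finset V := {y | ∃ K, AltTrail E H v K y false}

open Classical in
/-- The ends of alternating trails of odd length. -/
noncomputable def odd (_ : IsDeficientOptimum E a b H f v) : Finset V := {x | ∃ K, AltTrail E H v K x true}

theorem mem_even (h : IsDeficientOptimum E a b H f v) {y : V} :
    y ∈ h.even ↔ ∃ K, AltTrail E H v K y false := by simp [even]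

theorem mem_odd (h : IsDeficientOptimum E a b H f v) {y : V} :
    y ∈ h.odd ↔ ∃ K, AltTrail E H v K y true := by simp [odd]

theorem self_mem_even (h : IsDeficientOptimum E a b H f v) : v ∈ h.even :=
  h.mem_even.2 ⟨H, .nil⟩

theorem edgeDeg_of_mem_odd (h : IsDeficientOptimum E a b H f v) {x : V} (hx : x ∈ h.odd) :
    edgeDeg H x = f x + 1 :=
  let ⟨_, hK⟩ := h.mem_odd.1 hx
  (h.odd_end hK).2

theorem edgeDeg_of_mem_even (h : IsDeficientOptimum E a b H f v) {y : V} (hy : y ∈ h.even) :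
    edgeDeg H y ≤ f y :=
  let ⟨_, hK⟩ := h.mem_even.1 hy
  h.even_end hK

theorem not_mem_odd (h : IsDeficientOptimum E a b H f v) {y : V} (hy : y ∈ h.even) :
    y ∉ h.odd := fun hx => by
  have := h.edgeDeg_of_mem_odd hx
  have := h.edgeDeg_of_mem_even hy
  omega

/-- An unflipped edge extends the trail. A flipped one has an even and an odd end, and `y` cannot be
the odd one. -/
theorem mem_odd_of_not_mem (h : IsDeficientOptimum E a b H f v) {y x : V} (hy : y ∈ h.even)
    (h1 : s(y, x) ∈ E) (h2 : s(y, x) ∉ H) : x ∈ h.odd := by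
  obtain ⟨K, hK⟩ := h.mem_even.1 hy
  by_cases h3 : s(y, x) ∈ K
  · obtain ⟨p, q, he, hp, hq⟩ := hK.flipped (e := s(y, x)) (by tauto)
    obtain ⟨rfl, rfl⟩ | ⟨rfl, rfl⟩ := Sym2.eq_iff.1 he
    · exact h.mem_odd.2 hq
    · exact absurd (h.mem_odd.2 hq) (h.not_mem_odd hy)
  · exact h.mem_odd.2 ⟨_, hK.add h1 h2 h3⟩

theorem mem_even_of_mem (h : IsDeficientOptimum E a b H f v) {y x : V} (hx : x ∈ h.odd)
    (h2 : s(x, y) ∈ H) : y ∈ h.even := by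
  obtain ⟨K, hK⟩ := h.mem_odd.1 hx
  by_cases h3 : s(x, y) ∈ K
  · exact h.mem_even.2 ⟨_, hK.remove h2 h3⟩
  · obtain ⟨p, q, he, hp, hq⟩ := hK.flipped (e := s(x, y)) (by tauto)
    obtain ⟨rfl, rfl⟩ | ⟨rfl, rfl⟩ := Sym2.eq_iff.1 he
    · exact absurd hx (h.not_mem_odd (h.mem_even.2 hp))
    · exact h.mem_even.2 hp

/-- An odd vertex with the lower target has few edges outside `H` to even vertices: otherwise it
could be switched to the upper target. -/
theorem card_not_mem_lt (h : IsDeficientOptimum E a b H f v) {x : V} (hx : x ∈ h.odd)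
    (hfx : f x = a x) (hab : a x + 2 ≤ b x) :
    #{y ∈ h.even | s(x, y) ∈ E ∧ s(x, y) ∉ H} + a x + 1 < b x := by
  -- After the flip `x` has degree `a x + 2`; a star to even vertices raises it to exactly `b x`.
  -- Even vertices have no surplus, so they tolerate one more edge, and `v`, being deficient,
  -- tolerates two.
  by_contra! hc
  obtain ⟨K, hK⟩ := h.mem_odd.1 hx
  have hdx := h.edgeDeg_of_mem_odd hx
  have hxv := (h.odd_end hK).1
  have hd := hK.edgeDeg_eq h.loopless h.feasible.subset
  simp only [and_true, Bool.true_eq_false, and_false, if_false, add_zero] at hd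
  have hxA : x ∉ h.even := fun hA => h.not_mem_odd hA hx
  have hdK : edgeDeg K x = a x + 2 := by have := hd x; simp [hxv] at this; omega
  have hcard : b x - edgeDeg K x ≤ #{y ∈ h.even | s(x, y) ∈ E ∧ s(x, y) ∉ K} := by
    have h1 : edgeDeg H x ≤ #{y ∈ h.even | s(x, y) ∈ H} :=
      card_le_card fun y hy => by
        simp only [mem_filter, mem_univ, true_and] at hy ⊢
        exact ⟨h.mem_even_of_mem hx hy, hy⟩
    have h2 : #{y ∈ h.even | s(x, y) ∈ H} + #{y ∈ h.even | s(x, y) ∈ E ∧ s(x, y) ∉ H} ≤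
        edgeDeg K x + #{y ∈ h.even | s(x, y) ∈ E ∧ s(x, y) ∉ K} := by
      unfold edgeDeg
      rw [← card_union_of_disjoint]
      · refine le_trans (card_le_card fun y hy => ?_) (card_union_le _ _)
        have : s(x, y) ∈ H → s(x, y) ∈ E := fun hh => h.feasible.subset hh
        simp only [mem_union, mem_filter, mem_univ, true_and] at hy ⊢
        tauto
      · rw [Finset.disjoint_left]
        intro y hy hy'
        simp only [mem_filter] at hy hy'
        tauto
    omega
  obtain ⟨S, hS, hSc⟩ := exists_subset_card_eq hcard
  have hSA : ∀ y ∈ S, y ∈ h.even ∧ s(x, y) ∈ E ∧ s(x, y) ∉ K := fun y hy => by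
    simpa using hS hy
  have hxS : x ∉ S := fun hh => hxA (hSA x hh).1
  have hdisj : Disjoint K (starEdges x S) := by
    rw [Finset.disjoint_right]
    intro e he
    obtain ⟨y, hy, rfl⟩ := mem_image.1 he
    exact (hSA y hy).2.2
  have hE' : starEdges x S ⊆ E := fun e he => by
    obtain ⟨y, hy, rfl⟩ := mem_image.1 he
    exact (hSA y hy).2.1
  have hself : edgeDeg (K ∪ starEdges x S) x = b x := by
    rw [edgeDeg_union hdisj, edgeDeg_starEdges_self hxS]; omega
  have hne : ∀ u, u ≠ x → edgeDeg (K ∪ starEdges x S) u =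
      edgeDeg H u + (if u = v then 1 else 0) + if u ∈ S then 1 else 0 := fun u hu => by
    have := hd u
    rw [edgeDeg_union hdisj, edgeDeg_starEdges_of_ne hu, this, if_neg hu, add_zero]
  refine h.no_improvement (K := K ∪ starEdges x S) (g := Function.update f x (b x))
    ⟨union_subset (hK.subset h.feasible.subset) hE', fun u => ?_, fun u => ?_⟩ (fun u => ?_) ?_
  · by_cases hu : u = x
    · subst hu; simp
    · simpa [hu] using h.feasible.target u
  · by_cases hu : u = x
    · subst hu; rw [hself]; simp
    · rw [hne u hu, Function.update_of_ne hu]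
      have hle := h.feasible.le u
      have hv := h.deficient
      have hA := fun huS => h.edgeDeg_of_mem_even (hSA u huS).1
      split_ifs with huv huS huS
      · subst huv; omega
      · subst huv; omega
      · have := hA huS; omega
      · omega
  · by_cases hu : u = x
    · subst hu; rw [hself]; simp
    · rw [hne u hu, Function.update_of_ne hu]; omega
  · have hv := h.deficient
    rw [hne v hxv.symm, Function.update_of_ne hxv.symm]
    simp only [if_true]; omega

/-- An even vertex with the upper target has few edges of `H` to odd vertices: otherwise it could
be switched to the lower target. -/
theorem card_mem_lt (h : IsDeficientOptimum E a b H f v) {y : V} (hy : y ∈ h.even)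
    (hfy : f y = b y) (hab : a y + 2 ≤ b y) :
    #{x ∈ h.odd | s(y, x) ∈ H} + a y + 1 < b y := by
  -- After the flip, edges from `y` to odd vertices are deleted until its degree is at most `a y +
  -- 1`. Odd vertices have a surplus of one, so none becomes deficient. Enough such edges exist:
  -- edges of `K` from `y` to other vertices lie in `H`, and there are at most `a y + 1` of them.
  by_contra! hc
  obtain ⟨K, hK⟩ := h.mem_even.1 hy
  have hdy := h.edgeDeg_of_mem_even hy
  have hd := hK.edgeDeg_eq h.loopless h.feasible.subset
  simp only [and_true, Bool.false_eq_true, and_false, if_false, add_zero] at hd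
  have hyB := h.not_mem_odd hy
  have hcard : edgeDeg K y - (a y + 1) ≤ #{x ∈ h.odd | s(y, x) ∈ K} := by
    have h1 := edgeDeg_eq_add K y h.odd
    have h2 := edgeDeg_eq_add H y h.odd
    have h3 : #{x | s(y, x) ∈ K ∧ x ∉ h.odd} ≤ #{x | s(y, x) ∈ H ∧ x ∉ h.odd} := by
      refine card_le_card fun x hx => ?_
      simp only [mem_filter, mem_univ, true_and] at hx ⊢
      refine ⟨?_, hx.2⟩
      by_contra hH
      exact hx.2 (h.mem_odd_of_not_mem hy (hK.subset h.feasible.subset hx.1) hH)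
    omega
  obtain ⟨S, hS, hSc⟩ := exists_subset_card_eq hcard
  have hSB : ∀ x ∈ S, x ∈ h.odd ∧ s(y, x) ∈ K := fun x hx => by simpa using hS hx
  have hyS : y ∉ S := fun hh => hyB (hSB y hh).1
  have hsub : starEdges y S ⊆ K := fun e he => by
    obtain ⟨x, hx, rfl⟩ := mem_image.1 he
    exact (hSB x hx).2
  have hself : edgeDeg (K \ starEdges y S) y + (edgeDeg K y - (a y + 1)) = edgeDeg K y := by
    rw [← hSc, ← edgeDeg_starEdges_self hyS, edgeDeg_sdiff hsub y]
  have hdy' := hd y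
  simp only [if_true] at hdy'
  have hne : ∀ u, u ≠ y → edgeDeg (K \ starEdges y S) u + (if u ∈ S then 1 else 0) =
      edgeDeg H u + (if u = v then 1 else 0) := fun u hu => by
    have := hd u
    rw [← edgeDeg_starEdges_of_ne hu, edgeDeg_sdiff hsub]; simpa [hu] using this
  have hv := h.deficient
  refine h.no_improvement (K := K \ starEdges y S) (g := Function.update f y (a y))
    ⟨sdiff_subset.trans (hK.subset h.feasible.subset), fun u => ?_, fun u => ?_⟩ (fun u => ?_) ?_
  · by_cases hu : u = y
    · subst hu; simp
    · simpa [hu] using h.feasible.target u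
  · by_cases hu : u = y
    · subst hu; simp only [Function.update_self]; omega
    · rw [Function.update_of_ne hu]
      have hle := h.feasible.le u
      have hn := hne u hu
      by_cases huv : u = v
      · subst huv; simp only [if_true] at hn; omega
      · simp only [huv, if_false] at hn; omega
  · by_cases hu : u = y
    · subst hu; simp only [Function.update_self]
      by_cases huv : u = v
      · subst huv; simp only [if_true] at hdy'; omega
      · simp only [huv, if_false] at hdy'; omega
    · rw [Function.update_of_ne hu]
      have hn := hne u hu
      by_cases hS : u ∈ S
      · have := h.edgeDeg_of_mem_odd (hSB u hS).1
        simp only [hS, if_true] at hn; omega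
      · simp only [hS, if_false] at hn; omega
  · by_cases hu : v = y
    · subst hu; simp only [Function.update_self]
      simp only [if_true] at hdy'; omega
    · rw [Function.update_of_ne hu]
      have hn := hne v hu
      have : v ∉ S := fun hS => h.not_mem_odd h.self_mem_even (hSB v hS).1
      simp only [this, if_false, if_true] at hn; omega

end IsDeficientOptimum

/-- A theorem of Addario-Berry, Dalal and Reed on degree constrained subgraphs. -/
theorem exists_subset_edgeDeg (E : Finset (Sym2 V)) (hE : ∀ e ∈ E, ¬ e.IsDiag) (a b : V → ℕ)
    (hab : ∀ v, a v + 2 ≤ b v) (ha : ∀ v, 2 * a v < edgeDeg E v)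
    (hb : ∀ v, edgeDeg E v ≤ 2 * b v + 2) (hab' : ∀ v, 2 * b v ≤ edgeDeg E v + a v + 1)
    (hba : ∀ v, b v ≤ 2 * a v + 3) :
    ∃ H ⊆ E, ∀ v, edgeDeg H v = a v ∨ edgeDeg H v = a v + 1 ∨ edgeDeg H v = b v ∨
      edgeDeg H v = b v + 1 := by
  have hex : ∃ n, ∃ K g, IsFeasible E a b K g ∧ ∑ u, (g u - edgeDeg K u) = n :=
    ⟨_, ∅, a, ⟨empty_subset _, fun v => .inl rfl, fun v => by simp [edgeDeg]⟩, rfl⟩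
  classical
  obtain ⟨H, f, hf, hn⟩ := Nat.find_spec hex
  have hmin : ∀ K g, IsFeasible E a b K g →
      ∑ u, (f u - edgeDeg H u) ≤ ∑ u, (g u - edgeDeg K u) := fun K g hK =>
    hn.le.trans (Nat.find_min' hex ⟨K, g, hK, rfl⟩)
  refine ⟨H, hf.subset, fun v => ?_⟩
  by_contra hcon
  have hdef : edgeDeg H v < f v := by
    have := hf.le v
    rcases hf.target v with h | h <;> omega
  have h : IsDeficientOptimum E a b H f v := ⟨hE, hf, hmin, hdef⟩
  have hsplit : ∀ u, edgeDeg E u = edgeDeg H u + edgeDeg (E \ H) u := fun u => by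
    have := edgeDeg_sdiff hf.subset u; omega
  -- Between even and odd vertices, the even side sees more edges outside `H` than inside, the odd
  -- side at most as many: a contradiction on summing.
  have hevenlt : ∀ y ∈ h.even,
      #{x ∈ h.odd | s(y, x) ∈ H} < #{x ∈ h.odd | s(y, x) ∈ E \ H} := by
    intro y hy
    have h1 : edgeDeg (E \ H) y ≤ #{x ∈ h.odd | s(y, x) ∈ E \ H} :=
      card_le_card fun x hx => by
        simp only [mem_filter, mem_univ, true_and] at hx ⊢
        have := mem_sdiff.1 hx
        exact ⟨h.mem_odd_of_not_mem hy this.1 this.2, hx⟩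
    have h2 : #{x ∈ h.odd | s(y, x) ∈ H} ≤ edgeDeg H y :=
      card_le_card fun x hx => by simpa using (mem_filter.1 hx).2
    have h3 := h.edgeDeg_of_mem_even hy
    have := hsplit y; have := ha y; have := hab' y
    rcases hf.target y with h4 | h4
    · omega
    · have := h.card_mem_lt hy h4 (hab y); omega
  have hoddle : ∀ x ∈ h.odd,
      #{y ∈ h.even | s(x, y) ∈ E \ H} ≤ #{y ∈ h.even | s(x, y) ∈ H} := by
    intro x hx
    have h1 : edgeDeg H x ≤ #{y ∈ h.even | s(x, y) ∈ H} :=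
      card_le_card fun y hy => by
        simp only [mem_filter, mem_univ, true_and] at hy ⊢
        exact ⟨h.mem_even_of_mem hx hy, hy⟩
    have h2 : #{y ∈ h.even | s(x, y) ∈ E \ H} ≤ edgeDeg (E \ H) x :=
      card_le_card fun x hx => by simpa using (mem_filter.1 hx).2
    have h3 := h.edgeDeg_of_mem_odd hx
    have := hsplit x; have := hb x; have := hba x
    rcases hf.target x with h4 | h4
    · have := h.card_not_mem_lt hx h4 (hab x)
      simp only [mem_sdiff] at *
      omega
    · omega
  have s1 := sum_lt_sum_of_nonempty ⟨v, h.self_mem_even⟩ hevenlt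
  have s2 := sum_le_sum hoddle
  rw [sum_card_filter_comm (p := fun e => e ∈ H), sum_card_filter_comm (p := fun e => e ∈ E \ H)] at s1
  omega

end DegreeConstrained

/-! ### Locally optimal assignments -/

section Assignment

variable {V : Type*} [Fintype V] [DecidableEq V]

theorem sum_sum_eq_of_symm (v : V) (c : V → V → ℕ) (hsymm : ∀ u w, c u w = c w u)
    (h0 : c v v = 0) :
    ∑ u, ∑ w, c u w = 2 * ∑ u, c v u + ∑ u ∈ univ.erase v, ∑ w ∈ univ.erase v, c u w := by
  rw [← add_sum_erase univ _ (mem_univ v), two_mul, add_assoc]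
  congr 1
  have h1 : ∑ u, c v u = ∑ u ∈ univ.erase v, c u v := by
    rw [← add_sum_erase univ _ (mem_univ v), h0, zero_add]
    exact sum_congr rfl fun u _ => hsymm _ _
  rw [h1, ← sum_add_distrib]
  exact sum_congr rfl fun u _ => (add_sum_erase univ _ (mem_univ v)).symm

/-- For a symmetric pairwise cost, there is an assignment for which no change at a single vertex
lowers the cost at that vertex. -/
theorem exists_local_optimum {S : Type*} (C : V → Finset S) (hC : ∀ v, (C v).Nonempty)
    (cost : V → V → S → S → ℕ) (hsymm : ∀ u w s t, cost u w s t = cost w u t s)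
    (h0 : ∀ v s t, cost v v s t = 0) :
    ∃ τ : V → S, (∀ v, τ v ∈ C v) ∧
      ∀ v, ∀ s ∈ C v, ∑ u, cost v u (τ v) (τ u) ≤ ∑ u, cost v u s (τ u) := by
  classical
  have hne : (Fintype.piFinset C).Nonempty := Fintype.piFinset_nonempty.2 hC
  -- A global minimiser suffices: changing one vertex changes the total by twice the change of its
  -- own cost.
  obtain ⟨τ, hτ, hmin⟩ := exists_min_image (Fintype.piFinset C)
    (fun τ => ∑ u, ∑ w, cost u w (τ u) (τ w)) hne
  rw [Fintype.mem_piFinset] at hτ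
  refine ⟨τ, hτ, fun v s hs => ?_⟩
  have h := hmin (Function.update τ v s) (Fintype.mem_piFinset.2 fun u => by
    by_cases hu : u = v
    · subst hu; simpa using hs
    · simpa [hu] using hτ u)
  rw [sum_sum_eq_of_symm v _ (fun u w => hsymm _ _ _ _) (h0 _ _ _),
    sum_sum_eq_of_symm v (fun u w => cost u w (Function.update τ v s u) _)
      (fun u w => hsymm _ _ _ _) (h0 _ _ _)] at h
  have h1 : ∑ u ∈ univ.erase v, ∑ w ∈ univ.erase v,
      cost u w (Function.update τ v s u) (Function.update τ v s w) =
      ∑ u ∈ univ.erase v, ∑ w ∈ univ.erase v, cost u w (τ u) (τ w) :=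
    sum_congr rfl fun u hu => sum_congr rfl fun w hw => by
      rw [Function.update_of_ne (ne_of_mem_erase hu), Function.update_of_ne (ne_of_mem_erase hw)]
  have h2 : ∑ u, cost v u (Function.update τ v s v) (Function.update τ v s u) =
      ∑ u, cost v u s (τ u) :=
    sum_congr rfl fun u _ => by
      by_cases hu : u = v
      · subst hu; simp [h0]
      · simp [hu]
  simp only [h1, h2] at h
  omega

end Assignment

/-! ### Coincidences between translates -/

section Coincidences

open scoped Pointwise

/-- The number of coincidences between the translates `x + P` and `y + Q`. -/
def coincidences (P Q : Finset ℕ) (x y : ℕ) : ℕ := #{p ∈ P ×ˢ Q | x + p.1 = y + p.2}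

theorem coincidences_comm (P Q : Finset ℕ) (x y : ℕ) :
    coincidences P Q x y = coincidences Q P y x := by
  refine card_nbij' Prod.swap Prod.swap ?_ ?_ ?_ ?_ <;> intro p hp <;> simp at * <;> tauto

theorem coincidences_pos {P Q : Finset ℕ} {x y p q : ℕ} (hp : p ∈ P) (hq : q ∈ Q)
    (h : x + p = y + q) : 0 < coincidences P Q x y :=
  card_pos.2 ⟨(p, q), by simp [hp, hq, h]⟩

/-- Each pair `(p, q)` determines the translation `i`, so it is counted at most once. -/
theorem sum_coincidences_le (P Q : Finset ℕ) (x y n : ℕ) :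
    ∑ i ∈ range n, coincidences P Q (x + i) y ≤ #P * #Q := by
  unfold coincidences
  simp only [card_filter]
  rw [sum_comm, ← card_product, card_eq_sum_ones]
  refine sum_le_sum fun p _ => ?_
  rw [← card_filter, card_le_one]
  intro i hi j hj
  simp only [mem_filter] at hi hj
  omega

/-- The offsets `0, 1, k, k + 1`. -/
def offsets (k : ℕ) : Finset ℕ := {0, 1, k, k + 1}

theorem card_offsets_le (k : ℕ) : #(offsets k) ≤ 4 := card_le_four

theorem card_offsets_add_le (k l : ℕ) : #(offsets k + offsets l) ≤ 16 :=
  card_add_le.trans (Nat.mul_le_mul (card_offsets_le k) (card_offsets_le l))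

theorem sum_coincidences_offsets_le (k l x y n : ℕ) :
    ∑ i ∈ range n, coincidences (offsets k) (offsets l) (x + i) y ≤ 16 :=
  (sum_coincidences_le _ _ _ _ _).trans
    (Nat.mul_le_mul (card_offsets_le k) (card_offsets_le l))

theorem sum_coincidences_offsets_add_le (k l k' l' x y n : ℕ) :
    ∑ i ∈ range n, coincidences (offsets k + offsets l) (offsets k' + offsets l') (x + i) y ≤
      256 :=
  (sum_coincidences_le _ _ _ _ _).trans
    (Nat.mul_le_mul (card_offsets_add_le k l) (card_offsets_add_le k' l'))

end Coincidences

/-! ### Choice of shifts with few conflicts -/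

section Shifts

open scoped Pointwise

/-- A vertex of degree `d` with shift `i` gets one of the degrees `firstBase d i + p` with
`p ∈ offsets (3 * (d / 100))` in the first subgraph. -/
def firstBase (d i : ℕ) : ℕ := d / 2 - 2 * (d / 100) + i

/-- A vertex of degree `d` with shift `j` gets one of the degrees `secondBase d j + p` with
`p ∈ offsets (6 * (d / 100))` in the second subgraph. -/
def secondBase (d j : ℕ) : ℕ := d / 4 - 3 * (d / 100) + j

/-- Coincidences between the possible degrees of two vertices in the first subgraph. -/
def firstConflicts (d d' i i' : ℕ) : ℕ :=
  coincidences (offsets (3 * (d / 100))) (offsets (3 * (d' / 100)))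
    (firstBase d i) (firstBase d' i')

/-- Coincidences between the possible degrees of two vertices in the second subgraph. -/
def secondConflicts (d d' j j' : ℕ) : ℕ :=
  coincidences (offsets (6 * (d / 100))) (offsets (6 * (d' / 100)))
    (secondBase d j) (secondBase d' j')

/-- Coincidences between the possible degrees of two vertices in the third subgraph. -/
def thirdConflicts (d d' : ℕ) (s s' : ℕ × ℕ) : ℕ :=
  coincidences (offsets (3 * (d / 100)) + offsets (6 * (d / 100)))
    (offsets (3 * (d' / 100)) + offsets (6 * (d' / 100)))
    -- Third degrees are `d` minus the other two; equality is stated with the subtracted terms moved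
    -- across.
    (d' + firstBase d s.1 + secondBase d s.2) (d + firstBase d' s'.1 + secondBase d' s'.2)

/-- The cost of a pair of adjacent vertices of degrees `d` and `d'` with shifts `s` and `s'`. -/
def conflictCost (d d' : ℕ) (s s' : ℕ × ℕ) : ℕ :=
  firstConflicts d d' s.1 s'.1 + secondConflicts d d' s.2 s'.2 + thirdConflicts d d' s s' +
    10 ^ 5 * (secondConflicts d d' s.2 s'.2 * thirdConflicts d d' s s')

theorem conflictCost_comm (d d' : ℕ) (s s' : ℕ × ℕ) :
    conflictCost d d' s s' = conflictCost d' d s' s := by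
  simp only [conflictCost, firstConflicts, secondConflicts, thirdConflicts]
  rw [coincidences_comm, coincidences_comm (offsets (6 * (d / 100))),
    coincidences_comm (offsets _ + offsets _)]

theorem sum_firstConflicts_le (d d' i' n : ℕ) :
    ∑ i ∈ range n, firstConflicts d d' i i' ≤ 16 :=
  sum_coincidences_offsets_le _ _ _ _ _

theorem sum_secondConflicts_le (d d' j' n : ℕ) :
    ∑ j ∈ range n, secondConflicts d d' j j' ≤ 16 :=
  sum_coincidences_offsets_le _ _ _ _ _

theorem sum_thirdConflicts_le (d d' j n : ℕ) (s' : ℕ × ℕ) :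
    ∑ i ∈ range n, thirdConflicts d d' (i, j) s' ≤ 256 := by
  refine le_of_eq_of_le (sum_congr rfl fun i _ => ?_) (sum_coincidences_offsets_add_le
    (3 * (d / 100)) (6 * (d / 100)) (3 * (d' / 100)) (6 * (d' / 100))
    (d' + (d / 2 - 2 * (d / 100)) + secondBase d j)
    (d + firstBase d' s'.1 + secondBase d' s'.2) n)
  unfold thirdConflicts
  congr 1
  simp only [firstBase]
  ring

/-- The linear terms give `16 + 16 + 256 = 288` per row. In the product the second factor does not
depend on `i`, so its double sum is at most `256 * 16 = 4096`, independently of `n`. -/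
theorem sum_conflictCost_le (d d' n : ℕ) (s' : ℕ × ℕ) :
    ∑ s ∈ range n ×ˢ range n, conflictCost d d' s s' ≤ 288 * n + 4096 * 10 ^ 5 := by
  rw [sum_product_right]
  have h (j : ℕ) : ∑ i ∈ range n, conflictCost d d' (i, j) s' ≤
      272 + n * secondConflicts d d' j s'.2 + 256 * 10 ^ 5 * secondConflicts d d' j s'.2 := by
    simp only [conflictCost, sum_add_distrib, ← mul_sum, sum_const, card_range, smul_eq_mul]
    have h1 := sum_firstConflicts_le d d' s'.1 n
    have h3 := sum_thirdConflicts_le d d' j n s'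
    have h4 := Nat.mul_le_mul_left (secondConflicts d d' j s'.2) h3
    linarith
  calc _ ≤ _ := sum_le_sum fun j _ => h j
    _ = 272 * n + (n + 256 * 10 ^ 5) * ∑ j ∈ range n, secondConflicts d d' j s'.2 := by
      simp only [sum_add_distrib, ← mul_sum, sum_const, card_range, smul_eq_mul]
      ring
    _ ≤ 272 * n + (n + 256 * 10 ^ 5) * 16 := by
      gcongr
      exact sum_secondConflicts_le _ _ _ _
    _ = _ := by ring

variable {V : Type*} [Fintype V] (G : SimpleGraph V) [DecidableRel G.Adj]

/-- At a local optimum the cost at `v` is at most its average over all `n * n` shifts. With `d ≤ 101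
* n` and `n ≥ 10 ^ 8` this is below `101 * 293 < 30000`. -/
theorem exists_shifts (hG : ∀ v, 10 ^ 10 ≤ G.degree v) :
    ∃ τ : V → ℕ × ℕ, (∀ v, (τ v).1 < G.degree v / 100 ∧ (τ v).2 < G.degree v / 100) ∧
      ∀ v, ∑ u ∈ G.neighborFinset v, conflictCost (G.degree v) (G.degree u) (τ v) (τ u) <
        30000 := by
  classical
  obtain ⟨τ, hτ, hmin⟩ := exists_local_optimum
    (fun v => range (G.degree v / 100) ×ˢ range (G.degree v / 100))
    (fun v => by
      have := hG v
      have : 0 < G.degree v / 100 := by omega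
      exact ⟨(0, 0), by simpa using this⟩)
    (fun v u s t => if G.Adj v u then conflictCost (G.degree v) (G.degree u) s t else 0)
    (fun u w s t => by simp only [G.adj_comm u w, conflictCost_comm])
    (fun v s t => by simp)
  refine ⟨τ, fun v => by simpa using hτ v, fun v => ?_⟩
  have hsum : ∀ s, ∑ u, (if G.Adj v u then
      conflictCost (G.degree v) (G.degree u) s (τ u) else 0) =
      ∑ u ∈ G.neighborFinset v, conflictCost (G.degree v) (G.degree u) s (τ u) := fun s => by
    rw [← sum_filter, SimpleGraph.neighborFinset_eq_filter]
  have hmin := hmin v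
  simp only [hsum] at hmin
  have hv := hG v
  set d := G.degree v with hd
  set n := d / 100 with hn
  set c := ∑ u ∈ G.neighborFinset v, conflictCost d (G.degree u) (τ v) (τ u) with hc
  have h1 : n * n * c ≤ d * (288 * n + 4096 * 10 ^ 5) :=
    calc n * n * c = ∑ s ∈ range n ×ˢ range n, c := by simp
      _ ≤ ∑ s ∈ range n ×ˢ range n, ∑ u ∈ G.neighborFinset v,
          conflictCost d (G.degree u) s (τ u) := sum_le_sum hmin
      _ = ∑ u ∈ G.neighborFinset v, ∑ s ∈ range n ×ˢ range n,
          conflictCost d (G.degree u) s (τ u) := sum_comm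
      _ ≤ ∑ u ∈ G.neighborFinset v, (288 * n + 4096 * 10 ^ 5) :=
        sum_le_sum fun u _ => sum_conflictCost_le _ _ _ _
      _ = _ := by simp [hd]
  have hn8 : 10 ^ 8 ≤ n := by omega
  have hdn : d ≤ 101 * n := by omega
  by_contra! hcon
  have h2 : n * (n * 30000) ≤ n * (101 * (288 * n + 4096 * 10 ^ 5)) :=
    calc n * (n * 30000) ≤ n * (n * c) := by gcongr
      _ = n * n * c := by ring
      _ ≤ _ := h1
      _ ≤ (101 * n) * (288 * n + 4096 * 10 ^ 5) := by gcongr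
      _ = _ := by ring
  have h3 := Nat.le_of_mul_le_mul_left h2 (by omega)
  omega

end Shifts

/-! ### Assembling the three subgraphs -/

section Decomposition

open scoped Pointwise

variable {V : Type*} [Fintype V]

theorem mem_offsets {k p : ℕ} : p ∈ offsets k ↔ p = 0 ∨ p = 1 ∨ p = k ∨ p = k + 1 := by
  simp [offsets]

theorem edgeDeg_le_of_conflicts [DecidableEq V] (G : SimpleGraph V) [DecidableRel G.Adj]
    (c c' : V → V → ℕ) (F : Finset (Sym2 V)) (hF : F ⊆ G.edgeFinset)
    (hc : ∀ v u, s(v, u) ∈ F → 0 < c v u) (hcc' : ∀ v u, c v u ≤ c' v u) {v : V} {r : ℕ}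
    (h : ∑ u ∈ G.neighborFinset v, c' v u < r) : edgeDeg F v < r :=
  calc edgeDeg F v = ∑ u ∈ ({u | s(v, u) ∈ F} : Finset V), 1 := card_eq_sum_ones _
    _ ≤ ∑ u ∈ ({u | s(v, u) ∈ F} : Finset V), c' v u :=
      sum_le_sum fun u hu => (hc v u (by simpa using hu)).trans_le (hcc' v u)
    _ ≤ ∑ u ∈ G.neighborFinset v, c' v u := by
      refine sum_le_sum_of_subset fun u hu => ?_
      have := hF (by simpa using hu)
      simpa using this
    _ < r := h

theorem edgeDeg_edgeFinset [DecidableEq V] (G : SimpleGraph V) [DecidableRel G.Adj] (v : V) :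
    edgeDeg G.edgeFinset v = G.degree v := by
  unfold edgeDeg
  rw [← SimpleGraph.card_neighborFinset_eq_degree, SimpleGraph.neighborFinset_eq_filter]
  simp

theorem isLocallyIrregular_fromEdgeSet [DecidableEq V] (F : Finset (Sym2 V))
    (hF : ∀ e ∈ F, ¬ e.IsDiag) (h : ∀ u v, s(u, v) ∈ F → edgeDeg F u ≠ edgeDeg F v) :
    (SimpleGraph.fromEdgeSet (F : Set (Sym2 V))).IsLocallyIrregular := by
  classical
  have hdeg : ∀ v, (SimpleGraph.fromEdgeSet (F : Set (Sym2 V))).degree v = edgeDeg F v := by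
    intro v
    rw [← edgeDeg_edgeFinset]
    congr 1
    ext e
    simp only [SimpleGraph.mem_edgeFinset, SimpleGraph.edgeSet_fromEdgeSet, Set.mem_sdiff,
      mem_coe]
    exact ⟨fun he => he.1, fun he => ⟨he, fun hd => hF e he hd⟩⟩
  intro u v huv
  have := h u v (by simpa using ((SimpleGraph.fromEdgeSet_adj _).1 huv).1)
  convert this <;> (rw [← hdeg]; congr!)

theorem SimpleGraph.isLocallyIrregularDecomposable_three [DecidableEq V] (G : SimpleGraph V)
    [DecidableRel G.Adj] (H₁ H₂ H₃ : Finset (Sym2 V)) (hu : H₁ ∪ H₂ ∪ H₃ = G.edgeFinset)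
    (h12 : Disjoint H₁ H₂) (h13 : Disjoint H₁ H₃) (h23 : Disjoint H₂ H₃)
    (h1 : ∀ u v, s(u, v) ∈ H₁ → edgeDeg H₁ u ≠ edgeDeg H₁ v)
    (h2 : ∀ u v, s(u, v) ∈ H₂ → edgeDeg H₂ u ≠ edgeDeg H₂ v)
    (h3 : ∀ u v, s(u, v) ∈ H₃ → edgeDeg H₃ u ≠ edgeDeg H₃ v) :
    G.IsLocallyIrregularDecomposable 3 := by
  have hE : ∀ e ∈ H₁ ∪ H₂ ∪ H₃, ¬ e.IsDiag := fun e he => by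
    rw [hu, SimpleGraph.mem_edgeFinset] at he
    exact G.not_isDiag_of_mem_edgeSet he
  refine ⟨![H₁, H₂, H₃], ?_, ?_, ?_⟩
  · rw [← SimpleGraph.coe_edgeFinset, ← hu]
    ext e
    simp [Fin.exists_fin_succ]
  · intro i j hij
    fin_cases i <;> fin_cases j <;> first
      | exact absurd rfl hij
      | simpa using h12
      | simpa using h12.symm
      | simpa using h13
      | simpa using h13.symm
      | simpa using h23
      | simpa using h23.symm
  · intro i
    fin_cases i
    · exact isLocallyIrregular_fromEdgeSet H₁ (fun e he => hE e (by simp [he])) h1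
    · exact isLocallyIrregular_fromEdgeSet H₂ (fun e he => hE e (by simp [he])) h2
    · exact isLocallyIrregular_fromEdgeSet H₃ (fun e he => hE e (by simp [he])) h3

/-- A decomposition with prescribed sets of possible degrees `firstBase d i + offsets`,
`secondBase d j + offsets`, which keeps the edges of `F₁`, `F₂`, `F₃` out of the first, second
and third subgraph. -/
theorem exists_decomposition_avoiding [DecidableEq V] (E : Finset (Sym2 V))
    (hE : ∀ e ∈ E, ¬ e.IsDiag) (hd : ∀ v, 10 ^ 10 ≤ edgeDeg E v) (τ : V → ℕ × ℕ)
    (hτ : ∀ v, (τ v).1 < edgeDeg E v / 100 ∧ (τ v).2 < edgeDeg E v / 100)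
    (F₁ F₂ F₃ : Finset (Sym2 V)) (hF₁ : F₁ ⊆ E) (h23 : Disjoint F₂ F₃)
    (hr₁ : ∀ v, edgeDeg F₁ v < 30000) (hr₂ : ∀ v, edgeDeg F₂ v < 30000)
    (hr₃ : ∀ v, edgeDeg F₃ v < 30000) :
    ∃ H₁ H₂ H₃ : Finset (Sym2 V), H₁ ∪ H₂ ∪ H₃ = E ∧ Disjoint H₁ H₂ ∧ Disjoint H₁ H₃ ∧
      Disjoint H₂ H₃ ∧ Disjoint H₁ F₁ ∧ Disjoint H₂ F₂ ∧ Disjoint H₃ F₃ ∧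
      (∀ v, ∃ p ∈ offsets (3 * (edgeDeg E v / 100)),
        edgeDeg H₁ v = firstBase (edgeDeg E v) (τ v).1 + p) ∧
      (∀ v, ∃ p ∈ offsets (6 * (edgeDeg E v / 100)),
        edgeDeg H₂ v = secondBase (edgeDeg E v) (τ v).2 + p) := by
  have hsd₁ (v : V) := edgeDeg_sdiff hF₁ v
  -- For every shift below `d / 100` the two targets straddle half the available degree, with a
  -- margin of order `d / 100` that outweighs the 30000 lost edges.
  obtain ⟨H₁, hH₁, hdeg₁⟩ := exists_subset_edgeDeg (E \ F₁) (fun e he => hE e (sdiff_subset he))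
    (fun v => firstBase (edgeDeg E v) (τ v).1)
    (fun v => firstBase (edgeDeg E v) (τ v).1 + 3 * (edgeDeg E v / 100))
    (fun v => by have := hd v; omega)
    (fun v => by
      have := hd v; have := hsd₁ v; have := hr₁ v; have := (hτ v).1; unfold firstBase; omega)
    (fun v => by
      have := hd v; have := hsd₁ v; have := hr₁ v; have := (hτ v).1; unfold firstBase; omega)
    (fun v => by
      have := hd v; have := hsd₁ v; have := hr₁ v; have := (hτ v).1; unfold firstBase; omega)
    (fun v => by
      have := hd v; have := hsd₁ v; have := hr₁ v; have := (hτ v).1; unfold firstBase; omega)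
  have hH₁E : H₁ ⊆ E := hH₁.trans sdiff_subset
  have hsd₂ (v : V) := edgeDeg_sdiff hH₁E v
  set E' := E \ H₁ with hE'
  have hP : Disjoint (E' ∩ F₂) (E' ∩ F₃) := h23.mono inter_subset_right inter_subset_right
  have hP2 (v : V) : edgeDeg (E' ∩ F₂) v < 30000 :=
    (edgeDeg_mono inter_subset_right v).trans_lt (hr₂ v)
  have hP3 (v : V) : edgeDeg (E' ∩ F₃) v < 30000 :=
    (edgeDeg_mono inter_subset_right v).trans_lt (hr₃ v)
  have hsd₃ (v : V) := edgeDeg_sdiff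
    (union_subset inter_subset_left inter_subset_left : E' ∩ F₂ ∪ E' ∩ F₃ ⊆ E') v
  simp only [edgeDeg_union hP] at hsd₃
  set E'' := E' \ (E' ∩ F₂ ∪ E' ∩ F₃) with hE''
  have hlow (v : V) : secondBase (edgeDeg E v) (τ v).2 ≤ edgeDeg E v / 4 -
      2 * (edgeDeg E v / 100) ∧ edgeDeg E v / 4 - 3 * (edgeDeg E v / 100) ≤
      secondBase (edgeDeg E v) (τ v).2 := by
    have := (hτ v).2; have := hd v
    unfold secondBase; omega
  have hE''deg (v : V) : edgeDeg E v / 2 - 2 * (edgeDeg E v / 100) - 60002 ≤ edgeDeg E'' v ∧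
      edgeDeg E'' v ≤ edgeDeg E v / 2 + 2 * (edgeDeg E v / 100) + 1 := by
    have h1 := hd v; have h2 := hsd₂ v; have h3 := hsd₃ v; have h4 := hP2 v; have h5 := hP3 v
    have h6 := (hτ v).1; have h7 := hdeg₁ v
    unfold firstBase at h7
    omega
  -- The forced edges `E' ∩ F₃` join the second subgraph later, so the targets are lowered by their
  -- number. The wider gap allows for the uncertainty of about `2 * (d / 100)` in the remaining
  -- degree.
  obtain ⟨K, hK, hdegK⟩ := exists_subset_edgeDeg E''
    (fun e he => hE e (sdiff_subset (sdiff_subset he)))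
    (fun v => secondBase (edgeDeg E v) (τ v).2 - edgeDeg (E' ∩ F₃) v)
    (fun v => secondBase (edgeDeg E v) (τ v).2 - edgeDeg (E' ∩ F₃) v +
      6 * (edgeDeg E v / 100))
    (fun v => by have := hd v; omega)
    (fun v => by
      have := hd v; have := hE''deg v; have := hP3 v; have := hlow v; omega)
    (fun v => by
      have := hd v; have := hE''deg v; have := hP3 v; have := hlow v; omega)
    (fun v => by
      have := hd v; have := hE''deg v; have := hP3 v; have := hlow v; omega)
    (fun v => by
      have := hd v; have := hE''deg v; have := hP3 v; have := hlow v; omega)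
  have hKE' : K ⊆ E' := hK.trans sdiff_subset
  have hKP : Disjoint K (E' ∩ F₂ ∪ E' ∩ F₃) := sdiff_disjoint.mono_left hK
  rw [disjoint_union_right] at hKP
  have hsub : K ∪ E' ∩ F₃ ⊆ E' := union_subset hKE' inter_subset_left
  refine ⟨H₁, K ∪ E' ∩ F₃, E' \ (K ∪ E' ∩ F₃), ?_, ?_, ?_, disjoint_sdiff, ?_, ?_, ?_, ?_, ?_⟩
  · rw [union_assoc, union_sdiff_of_subset hsub, hE', union_sdiff_of_subset hH₁E]
  · exact disjoint_sdiff.mono_right hsub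
  · exact disjoint_sdiff.mono_right sdiff_subset
  · exact sdiff_disjoint.mono_left hH₁
  · rw [disjoint_union_left]
    refine ⟨?_, h23.symm.mono_left inter_subset_right⟩
    rw [Finset.disjoint_left]
    exact fun e he he' => Finset.disjoint_left.1 hKP.1 he (mem_inter.2 ⟨hKE' he, he'⟩)
  · rw [Finset.disjoint_left]
    intro e he he'
    simp only [mem_sdiff, mem_union, mem_inter] at he
    tauto
  · intro v
    have := hdeg₁ v
    refine ⟨edgeDeg H₁ v - firstBase (edgeDeg E v) (τ v).1, mem_offsets.2 ?_, ?_⟩ <;> omega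
  · intro v
    have h1 := hdegK v; have h2 := hd v; have h3 := hlow v; have h4 := hP3 v
    rw [edgeDeg_union hKP.2]
    refine ⟨edgeDeg K v + edgeDeg (E' ∩ F₃) v - secondBase (edgeDeg E v) (τ v).2,
      mem_offsets.2 ?_, ?_⟩ <;> omega

end Decomposition

/-! ### The main theorem -/

theorem mainTheorem1 {V : Type*} [Fintype V] (G : SimpleGraph V) [DecidableRel G.Adj]
    (hG : 10 ^ 10 ≤ G.minDegree) :
    G.IsLocallyIrregularDecomposable 3 := by
  classical
  have hdeg : ∀ v, 10 ^ 10 ≤ G.degree v := fun v => hG.trans (G.minDegree_le_degree v)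
  obtain ⟨τ, hτ, hcost⟩ := exists_shifts G hdeg
  let c₁ (v u : V) := firstConflicts (G.degree v) (G.degree u) (τ v).1 (τ u).1
  let c₂ (v u : V) := secondConflicts (G.degree v) (G.degree u) (τ v).2 (τ u).2
  let c₃ (v u : V) := thirdConflicts (G.degree v) (G.degree u) (τ v) (τ u)
  let c (v u : V) := conflictCost (G.degree v) (G.degree u) (τ v) (τ u)
  have hc : ∀ v u, c v u = c₁ v u + c₂ v u + c₃ v u + 10 ^ 5 * (c₂ v u * c₃ v u) :=
    fun _ _ => rfl
  have hsymm₁ : Std.Symm fun v u => 0 < c₁ v u := ⟨fun v u h => by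
    simpa only [c₁, firstConflicts, coincidences_comm] using h⟩
  have hsymm₂ : Std.Symm fun v u => 0 < c₂ v u := ⟨fun v u h => by
    simpa only [c₂, secondConflicts, coincidences_comm] using h⟩
  have hsymm₃ : Std.Symm fun v u => 0 < c₃ v u := ⟨fun v u h => by
    simpa only [c₃, thirdConflicts, coincidences_comm] using h⟩
  let F₁ := {e ∈ G.edgeFinset | e ∈ Sym2.fromRel hsymm₁}
  let F₂ := {e ∈ G.edgeFinset | e ∈ Sym2.fromRel hsymm₂}
  let F₃ := {e ∈ G.edgeFinset | e ∈ Sym2.fromRel hsymm₃}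
  have h23 : Disjoint F₂ F₃ := by
    rw [Finset.disjoint_left]
    intro e
    induction e with | _ v u
    intro h2 h3
    obtain ⟨he, h2⟩ := mem_filter.1 h2
    have h3 := (mem_filter.1 h3).2
    rw [Sym2.fromRel_prop] at h2 h3
    -- A common edge would cost at least the penalty `10 ^ 5`, above the bound at `v`.
    have h4 : c v u < 30000 := (single_le_sum (f := c v) (fun _ _ => Nat.zero_le _)
      (by simpa using he)).trans_lt (hcost v)
    have := Nat.mul_pos h2 h3
    have := hc v u
    omega
  have hr₁ (v : V) : edgeDeg F₁ v < 30000 := edgeDeg_le_of_conflicts G c₁ c F₁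
    (filter_subset _ _) (fun v u h => (Sym2.fromRel_prop (sym := hsymm₁)).1 (mem_filter.1 h).2)
    (fun v u => by have := hc v u; omega) (hcost v)
  have hr₂ (v : V) : edgeDeg F₂ v < 30000 := edgeDeg_le_of_conflicts G c₂ c F₂
    (filter_subset _ _) (fun v u h => (Sym2.fromRel_prop (sym := hsymm₂)).1 (mem_filter.1 h).2)
    (fun v u => by have := hc v u; omega) (hcost v)
  have hr₃ (v : V) : edgeDeg F₃ v < 30000 := edgeDeg_le_of_conflicts G c₃ c F₃
    (filter_subset _ _) (fun v u h => (Sym2.fromRel_prop (sym := hsymm₃)).1 (mem_filter.1 h).2)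
    (fun v u => by have := hc v u; omega) (hcost v)
  have hd := edgeDeg_edgeFinset G
  obtain ⟨H₁, H₂, H₃, hu, d12, d13, d23, d1, d2, d3, hH₁, hH₂⟩ :=
    exists_decomposition_avoiding G.edgeFinset
      (fun e he => G.not_isDiag_of_mem_edgeSet (SimpleGraph.mem_edgeFinset.1 he))
      (fun v => (hd v).symm ▸ hdeg v) τ (fun v => (hd v).symm ▸ hτ v) F₁ F₂ F₃
      (filter_subset _ _) h23 hr₁ hr₂ hr₃
  simp only [hd] at hH₁ hH₂
  have hsum (v : V) : edgeDeg H₁ v + edgeDeg H₂ v + edgeDeg H₃ v = G.degree v := by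
    rw [← hd, ← hu, edgeDeg_union (disjoint_union_left.2 ⟨d13, d23⟩), edgeDeg_union d12]
  refine G.isLocallyIrregularDecomposable_three H₁ H₂ H₃ hu d12 d13 d23 ?_ ?_ ?_
  · intro u v huv heq
    obtain ⟨p, hp, hpu⟩ := hH₁ u
    obtain ⟨q, hq, hqv⟩ := hH₁ v
    have : 0 < c₁ u v := coincidences_pos hp hq (by omega)
    exact Finset.disjoint_left.1 d1 huv
      (mem_filter.2 ⟨by rw [← hu]; simp [huv], Sym2.fromRel_prop.2 this⟩)
  · intro u v huv heq
    obtain ⟨p, hp, hpu⟩ := hH₂ u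
    obtain ⟨q, hq, hqv⟩ := hH₂ v
    have : 0 < c₂ u v := coincidences_pos hp hq (by omega)
    exact Finset.disjoint_left.1 d2 huv
      (mem_filter.2 ⟨by rw [← hu]; simp [huv], Sym2.fromRel_prop.2 this⟩)
  · intro u v huv heq
    obtain ⟨p, hp, hpu⟩ := hH₁ u
    obtain ⟨q, hq, hqv⟩ := hH₁ v
    obtain ⟨p', hp', hpu'⟩ := hH₂ u
    obtain ⟨q', hq', hqv'⟩ := hH₂ v
    have h1 := hsum u
    have h2 := hsum v
    have : 0 < c₃ u v :=
      coincidences_pos (Finset.add_mem_add hp hp') (Finset.add_mem_add hq hq') (by omega)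
    exact Finset.disjoint_left.1 d3 huv
      (mem_filter.2 ⟨by rw [← hu]; simp [huv], Sym2.fromRel_prop.2 this⟩)
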